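/- Define binary words over the alphabet $\{0,1\}$ by $G_0 = 001101000110$ and $G_{n+1} = G_n\, 01\, G_n^R$ for $n \ge 0$, where $w^R$ denotes the reversal of the word $w$. Then the infinite word $G_\infty = \lim_{n\to\infty} G_n$ exists (that is, for every $i$, the letter of $G_n$ at position $i$ is defined and equal to the letter of $G_\infty$ at position $i$ for all sufficiently large $n$), and it has the following properties: (a) $G_\infty$ is uniformly recurrent: for every finite factor $u$ of $G_\infty$ there is an $N$ such that every factor of $G_\infty$ of length $N$ contains $u$; (b) $G_\infty$ is aperiodic, i.e., not ultimately periodic: there are no $p \ge 1$ and $m \ge 0$ such that the letters at positions $n$ and $n+p$ agree for all $n \ge m$; (c) exactly $13$ distinct palindromes, counting the empty word, occur as factors of $G_\infty$. -/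

import Mathlib

open Filter

/-- The finite word `x i, x (i+1), …, x (i+n-1)` read in the infinite word `x`. -/
def window {α : Type*} (x : ℕ → α) (i n : ℕ) : List α :=
  (List.range n).map fun j => x (i + j)

/-- `u` is a factor of the infinite word `x` (the empty word is a factor of every word). -/
def IsFactor {α : Type*} (u : List α) (x : ℕ → α) : Prop :=
  ∃ i : ℕ, u = window x i u.length

/-- The set of palindromic factors of `x`, the empty word included. -/
def PalFac {α : Type*} (x : ℕ → α) : Set (List α) :=
  {u | IsFactor u x ∧ u.reverse = u}

/-- For every factor `u` of `x` there is a length `N` such that every factor of `x` of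
length `N` contains `u`. -/
def UniformlyRecurrent {α : Type*} (x : ℕ → α) : Prop :=
  ∀ u : List α, IsFactor u x →
    ∃ N : ℕ, ∀ v : List α, IsFactor v x → v.length = N → u <:+: v

/-- `x` is eventually periodic with some positive period. -/
def UltimatelyPeriodic {α : Type*} (x : ℕ → α) : Prop :=
  ∃ p : ℕ, 0 < p ∧ ∃ m : ℕ, ∀ n : ℕ, m ≤ n → x (n + p) = x n

/-- The infinite word `x` is the limit of the sequence of finite words `W`: at each position,
all but finitely many of the `W n` have a letter there, namely that of `x`. -/
def IsLimitWord {α : Type*} (W : ℕ → List α) (x : ℕ → α) : Prop :=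
  ∀ i : ℕ, ∀ᶠ n in atTop, (W n)[i]? = some (x i)

/-- `G 0 = 001101000110` and `G (n+1) = G n · 01 · (G n)ᴿ`. -/
def G : ℕ → List (Fin 2)
  | 0 => [0, 0, 1, 1, 0, 1, 0, 0, 0, 1, 1, 0]
  | n + 1 => G n ++ [0, 1] ++ (G n).reverse

/-- The infinite word whose letter at position `i` is that of `G i` (which is longer than `i`,
so the default letter is never used). -/
def Ginf (i : ℕ) : Fin 2 := (G i).getD i 0

/-! The limit word consists of copies of `G 0` and its reversal in alternation, separated by `01` or
`10` as the paperfolding sequence dictates; `G n` is its prefix of length `14 * 2 ^ n - 2`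
(`G_eq_window`). Recurrence and aperiodicity come from the arithmetic of paperfolding: a prefix
recurs at all multiples of a fixed length (`foldWord_add_mul`), while any period would force two
opposite folds to agree. A factor of length at most 8 meets at most one separator, so a finite check
finds the short palindromes and none of length 7 or 8; stripping end letters then excludes longer
ones. -/

/-- The regular paperfolding sequence: `fold (2 ^ a * m)` for odd `m` tells whether `m % 4 = 1`. -/
def fold (k : ℕ) : Bool := decide (k / 2 ^ padicValNat 2 k % 4 = 1)

/-- The letter at offset `j < 14` in a block made of `G 0` (or of its reversal, if `r` is true)
followed by `01` (or by `10`, if `s` is false). -/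
def blockLetter (r s : Bool) (j : ℕ) : Fin 2 :=
  if j < 12 then (G 0).getD (if r then 11 - j else j) 0
  else if s then (if j = 12 then 0 else 1) else (if j = 12 then 1 else 0)

/-- The infinite word whose `k`-th block of length 14 is given by the parity of `k` and by the
paperfolding sequence at `k + 1`. -/
def foldWord (i : ℕ) : Fin 2 :=
  blockLetter (decide (i / 14 % 2 = 1)) (fold (i / 14 + 1)) (i % 14)

theorem fold_two_pow_mul (a : ℕ) {m : ℕ} (hm : m % 2 = 1) :
    fold (2 ^ a * m) = decide (m % 4 = 1) := by
  have h0 : m ≠ 0 := by omega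
  have h : padicValNat 2 (2 ^ a * m) = a := by
    rw [padicValNat.mul (by positivity) h0, padicValNat.prime_pow,
      padicValNat.eq_zero_of_not_dvd (by omega), add_zero]
  rw [fold, h, Nat.mul_div_cancel_left _ (by positivity)]

theorem exists_eq_two_pow_mul_of_lt {n k : ℕ} (h0 : 0 < k) (hk : k < 2 ^ n) :
    ∃ a m : ℕ, m % 2 = 1 ∧ k = 2 ^ a * m ∧ a < n := by
  obtain ⟨a, m, hm, rfl⟩ := Nat.exists_eq_two_pow_mul_odd h0.ne'
  refine ⟨a, m, Nat.odd_iff.1 hm, rfl, ?_⟩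
  refine (Nat.pow_lt_pow_iff_right (a := 2) (by norm_num)).1 (lt_of_le_of_lt ?_ hk)
  exact Nat.le_mul_of_pos_right _ hm.pos

/-- As `a < n`, the odd part of `k` changes by a multiple of 4. -/
theorem fold_add_mul {n k : ℕ} (h0 : 0 < k) (hk : k < 2 ^ n) (c : ℕ) :
    fold (k + 2 ^ (n + 1) * c) = fold k := by
  obtain ⟨a, m, hm, rfl, ha⟩ := exists_eq_two_pow_mul_of_lt h0 hk
  obtain ⟨d, rfl⟩ := Nat.exists_eq_add_of_lt ha
  have h : 2 ^ a * m + 2 ^ (a + d + 1 + 1) * c = 2 ^ a * (m + 4 * (2 ^ d * c)) := by ring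
  rw [h, fold_two_pow_mul _ (by omega), fold_two_pow_mul _ hm]
  congr 2
  omega

/-- The odd part `m` becomes `4 * 2 ^ d - m`, which swaps the residues 1 and 3 mod 4. -/
theorem fold_sub {n k : ℕ} (h0 : 0 < k) (hk : k < 2 ^ n) :
    fold (2 ^ (n + 1) - k) = !fold k := by
  obtain ⟨a, m, hm, rfl, ha⟩ := exists_eq_two_pow_mul_of_lt h0 hk
  obtain ⟨d, rfl⟩ := Nat.exists_eq_add_of_lt ha
  have e : 2 ^ (a + d + 1) = 2 ^ a * (2 * 2 ^ d) := by ring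
  have hlt : m < 2 * 2 ^ d := by
    rw [e] at hk
    exact lt_of_mul_lt_mul_left hk (Nat.zero_le _)
  have h : 2 ^ (a + d + 1 + 1) - 2 ^ a * m = 2 ^ a * (4 * 2 ^ d - m) := by
    rw [Nat.mul_sub]
    congr 1
    ring
  rw [h, fold_two_pow_mul _ (by omega), fold_two_pow_mul _ hm, ← decide_not, decide_eq_decide]
  omega

theorem foldWord_block (k : ℕ) {j : ℕ} (hj : j < 14) :
    foldWord (14 * k + j) = blockLetter (decide (k % 2 = 1)) (fold (k + 1)) j := by
  rw [foldWord, show (14 * k + j) / 14 = k by omega, show (14 * k + j) % 14 = j by omega]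

theorem blockLetter_reverse_letter :
    ∀ (r s t : Bool), ∀ j < 12, blockLetter (!r) t (11 - j) = blockLetter r s j := by
  decide

theorem blockLetter_reverse_separator :
    ∀ (r t s : Bool), ∀ j < 14, 12 ≤ j → blockLetter r (!s) (25 - j) = blockLetter t s j := by
  decide

theorem blockLetter_separator_ne :
    ∀ (r t s : Bool), blockLetter r (!s) 12 ≠ blockLetter t s 12 := by
  decide

theorem blockLetter_congr_separator :
    ∀ (r s t : Bool), ∀ j < 12, blockLetter r s j = blockLetter r t j := by
  decide

/-- The prefix of length `14 * 2 ^ (n + 1) - 2` is the reversal of itself, except for its two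
middle letters. -/
theorem foldWord_reflect {n i : ℕ} (hi : i < 14 * 2 ^ n - 2) :
    foldWord (14 * 2 ^ (n + 1) - 3 - i) = foldWord i := by
  obtain ⟨k, j, hj, rfl⟩ : ∃ k j, j < 14 ∧ i = 14 * k + j :=
    ⟨i / 14, i % 14, Nat.mod_lt _ (by norm_num), by omega⟩
  have hp : 2 ^ (n + 1) = 2 * 2 ^ n := by ring
  rw [foldWord_block k hj]
  rcases lt_or_ge j 12 with h | h
  · rw [show 14 * 2 ^ (n + 1) - 3 - (14 * k + j) = 14 * (2 ^ (n + 1) - 1 - k) + (11 - j) by omega,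
      foldWord_block _ (by omega),
      show decide ((2 ^ (n + 1) - 1 - k) % 2 = 1) = !decide (k % 2 = 1) by
        rw [← decide_not, decide_eq_decide]; omega]
    exact blockLetter_reverse_letter _ _ _ j h
  -- Reversal maps offsets 12, 13 to 13, 12, turning `01` into `10`; `fold_sub` supplies the
  -- matching flip.
  · rw [show 14 * 2 ^ (n + 1) - 3 - (14 * k + j) = 14 * (2 ^ (n + 1) - 2 - k) + (25 - j) by omega,
      foldWord_block _ (by omega),
      show 2 ^ (n + 1) - 2 - k + 1 = 2 ^ (n + 1) - (k + 1) by omega,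
      fold_sub (by omega) (by omega)]
    exact blockLetter_reverse_separator _ _ _ j hj h

theorem foldWord_add_mul {n i : ℕ} (hi : i < 14 * 2 ^ n - 2) (c : ℕ) :
    foldWord (14 * 2 ^ (n + 1) * c + i) = foldWord i := by
  obtain ⟨k, j, hj, rfl⟩ : ∃ k j, j < 14 ∧ i = 14 * k + j :=
    ⟨i / 14, i % 14, Nat.mod_lt _ (by norm_num), by omega⟩
  have hpar : (k + 2 ^ (n + 1) * c) % 2 = k % 2 := by
    rw [show k + 2 ^ (n + 1) * c = k + 2 * (2 ^ n * c) by ring]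
    omega
  rw [show 14 * 2 ^ (n + 1) * c + (14 * k + j) = 14 * (k + 2 ^ (n + 1) * c) + j by ring,
    foldWord_block _ hj, foldWord_block _ hj, hpar]
  rcases lt_or_ge j 12 with h | h
  · exact blockLetter_congr_separator _ _ _ j h
  · rw [show k + 2 ^ (n + 1) * c + 1 = k + 1 + 2 ^ (n + 1) * c by ring,
      fold_add_mul (by omega) (by omega)]

theorem length_window {α : Type*} (x : ℕ → α) (i n : ℕ) : (window x i n).length = n := by
  simp [window]

theorem getElem_window {α : Type*} (x : ℕ → α) (i n j : ℕ) (h : j < (window x i n).length) :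
    (window x i n)[j] = x (i + j) := by
  simp [window]

theorem window_congr {α : Type*} {x y : ℕ → α} {i k n : ℕ}
    (h : ∀ j < n, x (i + j) = y (k + j)) : window x i n = window y k n :=
  List.map_congr_left fun j hj => h j (List.mem_range.1 hj)

theorem window_add {α : Type*} (x : ℕ → α) (i m n : ℕ) :
    window x i (m + n) = window x i m ++ window x (i + m) n := by
  simp [window, List.range_add, Function.comp_def, add_assoc]

theorem reverse_window {α : Type*} {x y : ℕ → α} {i k n : ℕ}
    (h : ∀ j < n, y (k + (n - 1 - j)) = x (i + j)) : (window x i n).reverse = window y k n := by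
  refine List.ext_getElem (by simp [window]) fun j hj _ => ?_
  have hj' : j < n := by simpa [window] using hj
  rw [List.getElem_reverse, getElem_window, getElem_window, length_window, ← h _ (by omega)]
  congr 1
  omega

theorem G_eq_window (n : ℕ) : G n = window foldWord 0 (14 * 2 ^ n - 2) := by
  induction n with
  | zero =>
    refine List.ext_getElem (by rw [length_window]; rfl) fun j hj _ => ?_
    have hj' : j < 12 := hj
    have h : ∀ s : Bool, ∀ j : Fin 12, (G 0)[(j : ℕ)]'j.2 = blockLetter false s j := by decide
    rw [getElem_window, show 0 + j = 14 * 0 + j by ring, foldWord_block _ (by omega)]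
    exact h _ ⟨j, hj'⟩
  | succ n ih =>
    have hpos : 1 ≤ 2 ^ n := Nat.one_le_two_pow
    have hp : 2 ^ (n + 1) = 2 * 2 ^ n := by ring
    have hsep : fold (2 ^ n) = true := by
      simpa using fold_two_pow_mul n (m := 1) (by norm_num)
    have h2 : window foldWord (14 * 2 ^ n - 2) 2 = [0, 1] := by
      have e : 2 ^ n - 1 + 1 = 2 ^ n := by omega
      have e0 : foldWord (14 * 2 ^ n - 2) = 0 := by
        rw [show 14 * 2 ^ n - 2 = 14 * (2 ^ n - 1) + 12 by omega,
          foldWord_block _ (by norm_num), e, hsep]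
        rfl
      have e1 : foldWord (14 * 2 ^ n - 2 + 1) = 1 := by
        rw [show 14 * 2 ^ n - 2 + 1 = 14 * (2 ^ n - 1) + 13 by omega,
          foldWord_block _ (by norm_num), e, hsep]
        rfl
      simp [window, List.range_succ, e0, e1]
    rw [show 14 * 2 ^ (n + 1) - 2 = (14 * 2 ^ n - 2) + 2 + (14 * 2 ^ n - 2) by omega,
      window_add, window_add, zero_add, h2, G, ih]
    congr 1
    refine reverse_window fun j hj => ?_
    rw [zero_add j, ← foldWord_reflect hj]
    congr 1
    omega

theorem getElem?_G {n i : ℕ} (h : i < 14 * 2 ^ n - 2) : (G n)[i]? = some (foldWord i) := by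
  rw [G_eq_window, List.getElem?_eq_getElem (by rwa [length_window]), getElem_window, zero_add]

theorem lt_length_G (i : ℕ) : i < 14 * 2 ^ i - 2 := by
  have : i < 2 ^ i := Nat.lt_two_pow_self
  omega

theorem Ginf_eq_foldWord : Ginf = foldWord := by
  funext i
  rw [Ginf, List.getD_eq_getElem?_getD, getElem?_G (lt_length_G i), Option.getD_some]

theorem isLimitWord_foldWord : IsLimitWord G foldWord := fun i =>
  eventually_atTop.2 ⟨i, fun _ hn => getElem?_G <| (lt_length_G i).trans_le <|
    Nat.sub_le_sub_right (Nat.mul_le_mul_left _ (Nat.pow_le_pow_right two_pos hn)) 2⟩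

theorem uniformlyRecurrent_foldWord : UniformlyRecurrent foldWord := by
  rintro u ⟨i, hu⟩
  set l := u.length
  set n := i + l
  set P := 14 * 2 ^ (n + 1) with hP
  have hP0 : 0 < P := by positivity
  -- Some multiple of `P` lies within distance `P` after any start `s`, and `u` occurs `i` letters
  -- after it.
  refine ⟨P + i + l, ?_⟩
  rintro v ⟨s, hv⟩ hlen
  rw [hlen] at hv
  obtain ⟨c, t, hct, ht⟩ : ∃ c t, P * c = s + t ∧ t ≤ P := by
    refine ⟨s / P + 1, P - s % P, ?_, Nat.sub_le _ _⟩
    have h1 := Nat.div_add_mod s P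
    have h2 := Nat.mod_lt s hP0
    rw [mul_add, mul_one]
    omega
  have hn := lt_length_G n
  have hocc : u = window foldWord (s + (t + i)) l := by
    rw [hu]
    refine window_congr fun j hj => ?_
    rw [show s + (t + i) + j = P * c + (i + j) by omega, hP, foldWord_add_mul (by omega)]
  refine ⟨window foldWord s (t + i), window foldWord (s + (t + i) + l) (P - t), ?_⟩
  rw [hv, show P + i + l = t + i + l + (P - t) by omega, window_add foldWord s (t + i + l),
    window_add foldWord s (t + i) l, ← hocc, add_assoc s (t + i) l]

theorem not_ultimatelyPeriodic_foldWord : ¬ UltimatelyPeriodic foldWord := by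
  rintro ⟨p, hp, m, h⟩
  have hmul : ∀ c n : ℕ, m ≤ n → foldWord (n + p * c) = foldWord n := by
    intro c n hn
    induction c with
    | zero => rfl
    | succ c ih => rw [mul_add, mul_one, ← add_assoc, h _ (by omega), ih]
  obtain ⟨a, q, hq, rfl⟩ := Nat.exists_eq_two_pow_mul_odd hp.ne'
  rw [Nat.odd_iff] at hq
  have hpos : 1 ≤ 2 ^ a := Nat.one_le_two_pow
  obtain ⟨k, hk⟩ : ∃ k, k + 1 = 2 ^ a * (4 * m + 1) :=
    ⟨2 ^ a * (4 * m + 1) - 1, Nat.sub_add_cancel (Nat.mul_pos hpos (by omega))⟩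
  have hkm : 4 * m + 1 ≤ k + 1 := hk ▸ Nat.le_mul_of_pos_left _ hpos
  -- 28 periods shift by whole blocks and change the odd part `4 * m + 1` by `2 * q`, which is 2 mod
  -- 4, so the fold flips.
  have hper := hmul 28 (14 * k + 12) (by omega)
  rw [show 14 * k + 12 + 2 ^ a * q * 28 = 14 * (k + 2 ^ a * (2 * q)) + 12 by ring,
    foldWord_block _ (by norm_num), foldWord_block _ (by norm_num),
    show k + 2 ^ a * (2 * q) + 1 = 2 ^ a * (4 * m + 1 + 2 * q) by rw [mul_add, ← hk]; ring, hk,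
    fold_two_pow_mul _ (by omega), fold_two_pow_mul _ (by omega),
    show decide ((4 * m + 1 + 2 * q) % 4 = 1) = !decide ((4 * m + 1) % 4 = 1) by
      rw [← decide_not, decide_eq_decide]; omega] at hper
  exact blockLetter_separator_ne _ _ _ hper

/-- The palindromes that occur in `Ginf`. -/
def palindromes : Finset (List (Fin 2)) :=
  {[], [0], [1], [0, 0], [1, 1], [0, 0, 0], [0, 1, 0], [1, 0, 1], [0, 1, 1, 0], [1, 0, 0, 1],
    [0, 0, 1, 0, 0], [1, 0, 0, 0, 1], [0, 0, 1, 1, 0, 0]}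

/-- The letter at offset `j < 26` from the start of a block, whose successor has the opposite
orientation. -/
def twoBlockLetter (r s : Bool) (j : ℕ) : Fin 2 :=
  if j < 14 then blockLetter r s j else blockLetter (!r) s (j - 14)

theorem foldWord_two_blocks (k : ℕ) {j : ℕ} (hj : j < 26) :
    foldWord (14 * k + j) = twoBlockLetter (decide (k % 2 = 1)) (fold (k + 1)) j := by
  rw [twoBlockLetter]
  split_ifs with h
  · exact foldWord_block k h
  · rw [show 14 * k + j = 14 * (k + 1) + (j - 14) by omega, foldWord_block _ (by omega),
      show decide ((k + 1) % 2 = 1) = !decide (k % 2 = 1) by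
        rw [← decide_not, decide_eq_decide]; omega]
    exact blockLetter_congr_separator _ _ _ _ (by omega)

theorem exists_window_eq_twoBlockLetter (i : ℕ) :
    ∃ r s : Bool, ∃ j < 14, ∀ n ≤ 8, window foldWord i n = window (twoBlockLetter r s) j n := by
  refine ⟨decide (i / 14 % 2 = 1), fold (i / 14 + 1), i % 14, Nat.mod_lt _ (by norm_num),
    fun n hn => window_congr fun j hj => ?_⟩
  rw [← foldWord_two_blocks _ (by omega)]
  congr 1
  omega

-- Lengths 7 and 8, one of each parity, are included to start the descent in
-- `length_le_of_palindrome`.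
set_option maxRecDepth 10000 in
theorem mem_palindromes_of_twoBlockLetter :
    ∀ r s : Bool, ∀ j < 14, ∀ n ≤ 8,
      (window (twoBlockLetter r s) j n).reverse = window (twoBlockLetter r s) j n →
        n ≤ 6 ∧ window (twoBlockLetter r s) j n ∈ palindromes := by
  decide +kernel

theorem mem_palindromes_of_le {i n : ℕ} (hn : n ≤ 8)
    (h : (window foldWord i n).reverse = window foldWord i n) :
    n ≤ 6 ∧ window foldWord i n ∈ palindromes := by
  obtain ⟨r, s, j, hj, hw⟩ := exists_window_eq_twoBlockLetter i
  rw [hw n hn] at h ⊢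
  exact mem_palindromes_of_twoBlockLetter r s j hj n hn h

theorem reverse_window_inner {α : Type*} {x : ℕ → α} {i n : ℕ}
    (h : (window x i (n + 2)).reverse = window x i (n + 2)) :
    (window x (i + 1) n).reverse = window x (i + 1) n := by
  have hmid : window x i (n + 2) =
      window x i 1 ++ window x (i + 1) n ++ window x (i + (1 + n)) 1 := by
    rw [show n + 2 = 1 + n + 1 by ring, window_add, window_add]
  rw [hmid, List.reverse_append, List.reverse_append, ← List.append_assoc] at h
  exact (List.append_inj (List.append_inj h (by simp [window])).1 (by simp [window])).2

theorem length_le_of_palindrome (n : ℕ) :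
    ∀ i, (window foldWord i n).reverse = window foldWord i n → n ≤ 6 := by
  induction n using Nat.strong_induction_on with
  | _ n ih =>
    intro i h
    rcases le_or_gt n 8 with hn | hn
    · exact (mem_palindromes_of_le hn h).1
    -- The inner palindrome has length at least 7, against the induction hypothesis.
    · obtain ⟨m, rfl⟩ := Nat.exists_eq_add_of_lt (show 1 < n by omega)
      rw [show 1 + m + 1 = m + 2 by ring] at h
      have := ih m (by omega) _ (reverse_window_inner h)
      omega

theorem palindromes_infix_G_two : ∀ u ∈ palindromes, u <:+: G 2 ∧ u.reverse = u := by
  decide +kernel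

theorem isFactor_of_infix_window {α : Type*} {x : ℕ → α} {u : List α} {i n : ℕ}
    (h : u <:+: window x i n) : IsFactor u x := by
  obtain ⟨a, b, hab⟩ := h
  have hlen : n = a.length + u.length + b.length := by
    simpa [length_window, add_assoc] using (congrArg List.length hab).symm
  rw [hlen, window_add, window_add] at hab
  exact ⟨i + a.length, (List.append_inj (List.append_inj hab (by simp [window])).1
    (by simp [window])).2⟩

theorem palFac_foldWord : PalFac foldWord = palindromes := by
  ext u
  constructor
  · rintro ⟨⟨i, hu⟩, hpal⟩
    rw [hu] at hpal
    have h6 := length_le_of_palindrome _ i hpal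
    rw [hu]
    exact (mem_palindromes_of_le (by omega) hpal).2
  · intro hu
    obtain ⟨h1, h2⟩ := palindromes_infix_G_two u hu
    rw [G_eq_window] at h1
    exact ⟨isFactor_of_infix_window h1, h2⟩

theorem theorem10 :
    IsLimitWord G Ginf ∧
    UniformlyRecurrent Ginf ∧
    ¬ UltimatelyPeriodic Ginf ∧
    (PalFac Ginf).ncard = 13 := by
  rw [Ginf_eq_foldWord]
  refine ⟨isLimitWord_foldWord, uniformlyRecurrent_foldWord, not_ultimatelyPeriodic_foldWord, ?_⟩
  rw [palFac_foldWord, Set.ncard_coe_finset]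
  rfl
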